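/- Let $P=(p_1,\dots,p_k)$ be a probability vector on a finite set of outcomes $\{x_1,\dots,x_k\}$; put $\log 0:=0$ (so that $0\log 0=0$; outcomes of probability zero almost surely do not occur). For probability vectors $Q=(q_1,\dots,q_k)$ let $$H(Q,P)=-\sum_{j=1}^k q_j\log p_j,\qquad H(P)=-\sum_{j=1}^k p_j\log p_j,\qquad V_I(P)=\sum_{j=1}^k p_j\,\bigl(-\log p_j-H(P)\bigr)^2,$$ and assume $V_I(P)>0$. Let $X_1,X_2,\dots$ be independent random variables on a probability space, each with distribution $P$, i.e. $\Pr(X_i=x_j)=p_j$ for all $i,j$. For $n\ge 1$ let $\hat P=\hat P_n$ be the maximum likelihood estimator of $P$ from $X_1,\dots,X_n$, that is, the probability vector $q$ on $\{x_1,\dots,x_k\}$ that maximizes $\prod_{i=1}^n q(X_i)$ over all probability vectors. Define the sample information dispersion $$\hat V_I(P)=\frac1{n-1}\sum_{i=1}^n\bigl(-\log p(X_i)-H(\hat P,P)\bigr)^2,\qquad p(x_j):=p_j .$$ Then, as $n\to\infty$, $$\sqrt n\cdot\frac{H(\hat P,P)-H(P)}{\sqrt{\hat V_I(P)}}\ \xrightarrow{\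 d\ }\ N(0,1),$$ where the statistic is assigned the value $0$ when $n=1$ or $\hat V_I(P)=0$. -/

import Mathlib

open MeasureTheory ProbabilityTheory Filter

namespace Surprise

noncomputable section

/-- Cross entropy `H(Q, P) = -∑ i, q i * log (p i)` of two distributions on a finite set of
outcomes, given by their probability vectors. -/
def crossEntropy {ι : Type*} [Fintype ι] (q p : ι → ℝ) : ℝ :=
  -∑ i, q i * Real.log (p i)

/-- Shannon entropy `H(P) = E_P[-log P(X)] = -∑ i, p i * log (p i)`. -/
def entropy {ι : Type*} [Fintype ι] (p : ι → ℝ) : ℝ :=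
  -∑ i, p i * Real.log (p i)

/-- Information dispersion `V_I(P) = E_P[(-log P(X) - H(P))²]`. -/
def infoDispersion {ι : Type*} [Fintype ι] (p : ι → ℝ) : ℝ :=
  ∑ i, p i * (-Real.log (p i) - entropy p) ^ 2

/-- The likelihood of the probability vector `q` at the i.i.d. sample `x 0, …, x (n - 1)`. -/
def likelihood {ι : Type*} {n : ℕ} (q : ι → ℝ) (x : Fin n → ι) : ℝ :=
  ∏ i, q (x i)

/-- `q` is a maximum likelihood estimate from the sample `x`: a probability vector whose
likelihood is maximal among all probability vectors. -/
def IsMaxLikelihood {ι : Type*} [Fintype ι] {n : ℕ} (x : Fin n → ι) (q : ι → ℝ) : Prop :=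
  q ∈ stdSimplex ℝ ι ∧ ∀ r ∈ stdSimplex ℝ ι, likelihood r x ≤ likelihood q x

/-- The sample information dispersion
`V̂_I(P) = (1 / (n - 1)) * ∑ i, (-log P(X = x i) - H(P̂, P))²`
of the sample `x`, where `phat` is the estimate `P̂`. The subtraction `n - 1` is in `ℝ`. -/
def sampleInfoDispersion {ι : Type*} [Fintype ι] {n : ℕ} (p phat : ι → ℝ) (x : Fin n → ι) : ℝ :=
  (1 / ((n : ℝ) - 1)) * ∑ i, (-Real.log (p (x i)) - crossEntropy phat p) ^ 2

end

end Surprise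

/-!
The maximum likelihood estimate of a sample is its vector of relative frequencies, so
`H(P̂, P)` is the sample mean of the independent, identically distributed variables
`Yᵢ = -log p(Xᵢ)`, whose mean is `H(P)` and whose variance is `V_I(P)`; likewise `V̂_I(P)` is
the sample variance of the `Yᵢ`. The statistic is therefore the studentized mean of the `Yᵢ`.

That the relative frequencies `e` are the only maximizer (`IsMaxLikelihood.eq_empiricalFreq`)
follows from `log t ≤ t - 1`: for a maximizer `q`,
`0 ≤ ∑ᵢ log (q xᵢ / e xᵢ) ≤ ∑ᵢ (q xᵢ / e xᵢ - 1) ≤ 0`, and equality forces `q = e` on the sample.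

Studentized means of square-integrable variables are asymptotically standard normal
(`tendstoInDistribution_studentized_mean`): the central limit theorem treats the numerator, the
strong law of large numbers shows that the sample variance converges almost surely to the true
variance (`tendsto_sampleVariance_ae`), and Slutsky's theorem combines the two.
-/

namespace Surprise

open scoped Topology

/-! ### Maximum likelihood estimates of a probability vector -/

/-- The relative frequency of the outcome `j` in the sample `x`. -/
noncomputable def empiricalFreq {ι : Type*} {n : ℕ} (x : Fin n → ι) (j : ι) : ℝ :=
  open Classical in (n : ℝ)⁻¹ * ∑ i, if x i = j then 1 else 0

section MaxLikelihood

variable {ι : Type*} {n : ℕ} (x : Fin n → ι)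

lemma empiricalFreq_nonneg (j : ι) : 0 ≤ empiricalFreq x j :=
  mul_nonneg (by positivity) (Finset.sum_nonneg fun i _ => by split_ifs <;> norm_num)

lemma empiricalFreq_pos (i : Fin n) : 0 < empiricalFreq x (x i) := by
  classical
  have hn : (0 : ℝ) < n := by exact_mod_cast i.pos
  refine mul_pos (inv_pos.2 hn) (Finset.sum_pos' (fun k _ => by split_ifs <;> norm_num) ?_)
  exact ⟨i, Finset.mem_univ i, by simp⟩

lemma exists_of_empiricalFreq_ne_zero {j : ι} (h : empiricalFreq x j ≠ 0) : ∃ i, x i = j := by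
  by_contra! hj
  exact h (by simp [empiricalFreq, hj])

variable [Fintype ι]

/-- The mean of `f` under the relative frequencies is its mean over the sample. -/
lemma sum_empiricalFreq_mul (f : ι → ℝ) :
    ∑ j, empiricalFreq x j * f j = (n : ℝ)⁻¹ * ∑ i, f (x i) := by
  classical
  simp_rw [empiricalFreq, mul_assoc, ← Finset.mul_sum, Finset.sum_mul]
  rw [Finset.sum_comm]
  simp

lemma sum_empiricalFreq (hn : n ≠ 0) : ∑ j, empiricalFreq x j = 1 := by
  have hn' : (n : ℝ) ≠ 0 := by exact_mod_cast hn
  simpa [hn'] using sum_empiricalFreq_mul x (fun _ => 1)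

lemma empiricalFreq_mem_stdSimplex (hn : n ≠ 0) : empiricalFreq x ∈ stdSimplex ℝ ι :=
  ⟨empiricalFreq_nonneg x, sum_empiricalFreq x hn⟩

variable {x} in
/-- The average of `q / e` over the sample, `e` being the relative frequencies, is the total mass
that `q` gives to the outcomes that occur. -/
lemma sum_div_empiricalFreq_le {q : ι → ℝ} (hq : q ∈ stdSimplex ℝ ι) (hn : n ≠ 0) :
    ∑ i, q (x i) / empiricalFreq x (x i) ≤ n := by
  have hn' : (0 : ℝ) < n := by positivity
  have h : ∑ j, empiricalFreq x j * (q j / empiricalFreq x j) ≤ 1 := by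
    rw [← hq.2]
    refine Finset.sum_le_sum fun j _ => ?_
    rcases eq_or_ne (empiricalFreq x j) 0 with h0 | h0
    · simpa [h0] using hq.1 j
    · rw [mul_div_cancel₀ _ h0]
  rw [sum_empiricalFreq_mul x (fun j => q j / empiricalFreq x j), inv_mul_le_iff₀ hn',
    mul_one] at h
  exact h

variable {x} in
/-- A nonempty sample has only one maximum likelihood estimate, its relative frequencies. -/
lemma IsMaxLikelihood.eq_empiricalFreq {q : ι → ℝ} (h : IsMaxLikelihood x q) (hn : n ≠ 0) :
    q = empiricalFreq x := by
  set e := empiricalFreq x with he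
  have epos (i) : 0 < e (x i) := empiricalFreq_pos x i
  have hle : likelihood e x ≤ likelihood q x := h.2 e (empiricalFreq_mem_stdSimplex x hn)
  have hprod : 0 < likelihood e x := Finset.prod_pos fun i _ => epos i
  have qpos (i) : 0 < q (x i) := by
    refine (h.1.1 (x i)).lt_of_ne fun h0 => (hprod.trans_le hle).ne' ?_
    exact Finset.prod_eq_zero (Finset.mem_univ i) h0.symm
  have hlog : 0 ≤ ∑ i, Real.log (q (x i) / e (x i)) := by
    rw [← Real.log_prod fun i _ => (div_pos (qpos i) (epos i)).ne', Finset.prod_div_distrib]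
    exact Real.log_nonneg ((one_le_div hprod).2 hle)
  have hsum : ∑ i, (q (x i) / e (x i) - 1) ≤ 0 := by
    simpa using sum_div_empiricalFreq_le h.1 hn
  have hterm (i) : Real.log (q (x i) / e (x i)) ≤ q (x i) / e (x i) - 1 :=
    Real.log_le_sub_one_of_pos (div_pos (qpos i) (epos i))
  -- Both sums vanish, so the termwise inequality `log t ≤ t - 1` is an equality throughout.
  have heq : ∀ i, q (x i) = e (x i) := by
    intro i
    have h1 := (Finset.sum_eq_sum_iff_of_le fun i _ => hterm i).1
      (le_antisymm (Finset.sum_le_sum fun i _ => hterm i) (hsum.trans hlog)) i (Finset.mem_univ i)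
    by_contra hne
    refine (Real.log_lt_sub_one_of_pos (div_pos (qpos i) (epos i)) fun h1 => hne ?_).ne h1
    exact (div_eq_one_iff_eq (epos i).ne').1 h1
  -- Thus `e ≤ q`, and the two vectors have the same total mass.
  have hpt : ∀ j, e j ≤ q j := by
    intro j
    rcases eq_or_ne (e j) 0 with h0 | h0
    · exact h0 ▸ h.1.1 j
    · obtain ⟨i, rfl⟩ := exists_of_empiricalFreq_ne_zero x h0
      exact (heq i).ge
  have hmass : ∑ j, e j = ∑ j, q j := (sum_empiricalFreq x hn).trans h.1.2.symm
  ext j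
  exact ((Finset.sum_eq_sum_iff_of_le fun j _ => hpt j).1 hmass j (Finset.mem_univ j)).symm

variable {x} in
lemma IsMaxLikelihood.crossEntropy_eq {q : ι → ℝ} (h : IsMaxLikelihood x q) (hn : n ≠ 0)
    (p : ι → ℝ) : crossEntropy q p = (n : ℝ)⁻¹ * ∑ i, -Real.log (p (x i)) := by
  rw [h.eq_empiricalFreq hn, ← sum_empiricalFreq_mul x (fun j => -Real.log (p j)), crossEntropy]
  simp

end MaxLikelihood

/-! ### Asymptotic normality of studentized means -/

section Studentized

variable {Ω : Type*}

/-- The unbiased sample variance of `Y 0, …, Y (n - 1)`; it is `0` for `n = 1`. -/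
noncomputable def sampleVariance (Y : ℕ → Ω → ℝ) (n : ℕ) (ω : Ω) : ℝ :=
  1 / ((n : ℝ) - 1) *
    ∑ i ∈ Finset.range n, (Y i ω - (n : ℝ)⁻¹ * ∑ k ∈ Finset.range n, Y k ω) ^ 2

lemma sampleVariance_eq (Y : ℕ → Ω → ℝ) {n : ℕ} (hn : n ≠ 0) (ω : Ω) :
    sampleVariance Y n ω = n / ((n : ℝ) - 1) *
      ((∑ i ∈ Finset.range n, Y i ω ^ 2) / n - ((∑ i ∈ Finset.range n, Y i ω) / n) ^ 2) := by
  have hn' : (n : ℝ) ≠ 0 := by exact_mod_cast hn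
  simp_rw [sampleVariance, sub_sq, Finset.sum_add_distrib, Finset.sum_sub_distrib,
    ← Finset.sum_mul, ← Finset.mul_sum, Finset.sum_const, Finset.card_range, nsmul_eq_mul]
  field_simp
  ring

variable [MeasurableSpace Ω] {μ : Measure Ω}

lemma measurable_sampleVariance {Y : ℕ → Ω → ℝ} (hY : ∀ i, Measurable (Y i)) (n : ℕ) :
    Measurable (sampleVariance Y n) := by
  unfold sampleVariance
  fun_prop

variable [IsProbabilityMeasure μ]

/-- The sample variance is strongly consistent. -/
lemma tendsto_sampleVariance_ae {Y : ℕ → Ω → ℝ} (hL : MemLp (Y 0) 2 μ) (hindep : iIndepFun Y μ)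
    (hident : ∀ i, IdentDistrib (Y i) (Y 0) μ μ) :
    ∀ᵐ ω ∂μ, Tendsto (fun n => sampleVariance Y n ω) atTop (𝓝 Var[Y 0; μ]) := by
  have h1 := strong_law_ae_real Y (hL.integrable (by norm_num))
    (fun i j hij => hindep.indepFun hij) hident
  have h2 := strong_law_ae_real (fun i ω => Y i ω ^ 2) hL.integrable_sq
    (fun i j hij => (hindep.indepFun hij).comp (φ := fun y : ℝ => y ^ 2)
      (ψ := fun y : ℝ => y ^ 2) (by fun_prop) (by fun_prop))
    (fun i => (hident i).comp (u := fun y : ℝ => y ^ 2) (by fun_prop))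
  have h3 : Tendsto (fun n : ℕ => (n : ℝ) / ((n : ℝ) - 1)) atTop (𝓝 1) := by
    simpa [sub_eq_add_neg] using tendsto_natCast_div_add_atTop (-1 : ℝ)
  filter_upwards [h1, h2] with ω hω1 hω2
  rw [variance_eq_sub hL]
  have h := h3.mul (hω2.sub (hω1.pow 2))
  rw [one_mul] at h
  refine h.congr' ?_
  filter_upwards [eventually_ne_atTop 0] with n hn
  exact (sampleVariance_eq Y hn ω).symm

/-- The studentized mean of independent, identically distributed square-integrable variables of
nonzero variance is asymptotically standard normal. -/
lemma tendstoInDistribution_studentized_mean {Y : ℕ → Ω → ℝ} (hY : ∀ i, Measurable (Y i))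
    (hL : MemLp (Y 0) 2 μ) (hV : Var[Y 0; μ] ≠ 0) (hindep : iIndepFun Y μ)
    (hident : ∀ i, IdentDistrib (Y i) (Y 0) μ μ) :
    TendstoInDistribution
      (fun (n : ℕ) ω => √(n : ℝ) * (((n : ℝ)⁻¹ * ∑ i ∈ Finset.range n, Y i ω - μ[Y 0]) /
        √(sampleVariance Y n ω)))
      atTop (id : ℝ → ℝ) (fun _ => μ) (gaussianReal 0 1) := by
  have hVnn : 0 ≤ Var[Y 0; μ] := variance_nonneg _ _
  have hs : √Var[Y 0; μ] ≠ 0 := (Real.sqrt_pos.2 (hVnn.lt_of_ne' hV)).ne'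
  have hlaw : HasLaw (fun z : ℝ => √Var[Y 0; μ] * z) (gaussianReal 0 Var[Y 0; μ].toNNReal)
      (gaussianReal 0 1) := by
    refine ⟨by fun_prop, ?_⟩
    rw [gaussianReal_map_const_mul]
    congr 1
    · simp
    · ext
      simp [hVnn]
  have hclt := tendstoInDistribution_inv_sqrt_mul_sum_sub hlaw hL hindep hident
  have hden_meas (n : ℕ) : AEMeasurable (fun ω => (√(sampleVariance Y n ω))⁻¹) μ :=
    (measurable_sampleVariance hY n).sqrt.inv.aemeasurable
  have hden : TendstoInMeasure μ (fun (n : ℕ) ω => (√(sampleVariance Y n ω))⁻¹) atTop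
      (fun _ => (√Var[Y 0; μ])⁻¹) := by
    refine tendstoInMeasure_of_tendsto_ae (fun n => (hden_meas n).aestronglyMeasurable) ?_
    filter_upwards [tendsto_sampleVariance_ae hL hindep hident] with ω hω
    exact ((Real.continuous_sqrt.tendsto _).comp hω).inv₀ hs
  have h := hclt.continuous_comp_prodMk_of_tendstoInMeasure_const
    (g := fun z : ℝ × ℝ => z.1 * z.2) (by fun_prop) hden hden_meas
  refine h.congr (fun n => .of_forall fun ω => ?_) (.of_forall fun z => ?_)
  · rcases eq_or_ne n 0 with rfl | hn
    · simp
    · have hn' : (0 : ℝ) < n := by positivity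
      have hsq : √(n : ℝ) ≠ 0 := (Real.sqrt_pos.2 hn').ne'
      have hsc : (√(n : ℝ))⁻¹ = √(n : ℝ) * (n : ℝ)⁻¹ := by
        rw [inv_eq_iff_eq_inv, mul_inv, inv_inv, ← div_eq_inv_mul, Real.div_sqrt]
      dsimp only
      rw [hsc]
      field_simp
  · simp only [id]
    field_simp

end Studentized

/-! ### Finitely valued random variables -/

section FiniteLaw

variable {Ω : Type*} [MeasurableSpace Ω] {μ : Measure Ω} [IsProbabilityMeasure μ]
  {ι : Type*} [Fintype ι] [MeasurableSpace ι] [MeasurableSingletonClass ι]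
  {p : ι → ℝ} {X : Ω → ι}

lemma integral_comp_of_finite_law (hX : Measurable X) (hlaw : ∀ j, μ.real {ω | X ω = j} = p j)
    (f : ι → ℝ) : ∫ ω, f (X ω) ∂μ = ∑ j, p j * f j := by
  have := Measure.isProbabilityMeasure_map (μ := μ) hX.aemeasurable
  rw [← integral_map hX.aemeasurable (measurable_of_finite f).aestronglyMeasurable,
    integral_fintype .of_finite]
  refine Finset.sum_congr rfl fun j _ => ?_
  rw [map_measureReal_apply hX (measurableSet_singleton j), smul_eq_mul, ← hlaw j]
  rfl

lemma memLp_comp_of_finite (hX : Measurable X) (f : ι → ℝ) : MemLp (fun ω => f (X ω)) 2 μ := by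
  refine .of_bound ((measurable_of_finite f).comp hX).aestronglyMeasurable (∑ j, ‖f j‖)
    (.of_forall fun ω => ?_)
  exact Finset.single_le_sum (f := fun j => ‖f j‖) (fun j _ => norm_nonneg _)
    (Finset.mem_univ (X ω))

lemma identDistrib_of_finite_law {X' : Ω → ι} (hX : Measurable X) (hX' : Measurable X')
    (hlaw : ∀ j, μ.real {ω | X ω = j} = p j) (hlaw' : ∀ j, μ.real {ω | X' ω = j} = p j) :
    IdentDistrib X X' μ μ := by
  refine ⟨hX.aemeasurable, hX'.aemeasurable, Measure.ext_of_singleton fun j => ?_⟩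
  rw [Measure.map_apply hX (measurableSet_singleton j),
    Measure.map_apply hX' (measurableSet_singleton j)]
  exact (measureReal_eq_measureReal_iff).1 ((hlaw j).trans (hlaw' j).symm)

lemma integral_neg_log_eq_entropy (hX : Measurable X) (hlaw : ∀ j, μ.real {ω | X ω = j} = p j) :
    ∫ ω, -Real.log (p (X ω)) ∂μ = entropy p := by
  rw [integral_comp_of_finite_law hX hlaw (fun j => -Real.log (p j)), entropy]
  simp

lemma variance_neg_log_eq_infoDispersion (hX : Measurable X)
    (hlaw : ∀ j, μ.real {ω | X ω = j} = p j) :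
    Var[fun ω => -Real.log (p (X ω)); μ] = infoDispersion p := by
  have hm : Measurable fun ω => -Real.log (p (X ω)) :=
    (measurable_of_finite fun j => -Real.log (p j)).comp hX
  rw [variance_eq_integral hm.aemeasurable, integral_neg_log_eq_entropy hX hlaw,
    integral_comp_of_finite_law hX hlaw (fun j => (-Real.log (p j) - entropy p) ^ 2),
    infoDispersion]

end FiniteLaw

end Surprise

theorem mainTheorem2 {Ω : Type*} [MeasurableSpace Ω] (μ : Measure Ω) [IsProbabilityMeasure μ]
    {ι : Type*} [Fintype ι] [MeasurableSpace ι] [MeasurableSingletonClass ι]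
    (p : ι → ℝ) (hp : p ∈ stdSimplex ℝ ι) (hV : 0 < Surprise.infoDispersion p)
    (X : ℕ → Ω → ι) (hX : ∀ i, Measurable (X i)) (hindep : iIndepFun X μ)
    (hlaw : ∀ i j, μ.real {ω | X i ω = j} = p j)
    (phat : ℕ → Ω → ι → ℝ)
    (hphat : ∀ n, 1 ≤ n → ∀ ω,
      Surprise.IsMaxLikelihood (fun i : Fin n => X i ω) (phat n ω)) :
    TendstoInDistribution
      (fun (n : ℕ) (ω : Ω) =>
        √(n : ℝ) * ((Surprise.crossEntropy (phat n ω) p - Surprise.entropy p) /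
          √(Surprise.sampleInfoDispersion p (phat n ω) (fun i : Fin n => X i ω))))
      atTop (id : ℝ → ℝ) (fun _ => μ) (gaussianReal 0 1) := by
  have hf : Measurable fun j => -Real.log (p j) := measurable_of_finite _
  have hident (i) : IdentDistrib (X i) (X 0) μ μ :=
    Surprise.identDistrib_of_finite_law (hX i) (hX 0) (hlaw i) (hlaw 0)
  have h := Surprise.tendstoInDistribution_studentized_mean (μ := μ)
    (Y := fun i ω => -Real.log (p (X i ω))) (fun i => hf.comp (hX i))
    (Surprise.memLp_comp_of_finite (hX 0) fun j => -Real.log (p j))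
    (by rw [Surprise.variance_neg_log_eq_infoDispersion (hX 0) (hlaw 0)]; exact hV.ne')
    (hindep.comp (fun _ j => -Real.log (p j)) fun _ => hf) fun i => (hident i).comp hf
  refine h.congr (fun n => .of_forall fun ω => ?_) .rfl
  -- For the empty sample `phat 0` is arbitrary, but the factor `√0` vanishes.
  rcases eq_or_ne n 0 with rfl | hn
  · simp
  · have hmle := hphat n (Nat.one_le_iff_ne_zero.2 hn) ω
    simp only [Surprise.integral_neg_log_eq_entropy (hX 0) (hlaw 0), Surprise.sampleVariance,
      Surprise.sampleInfoDispersion, hmle.crossEntropy_eq hn p, Finset.sum_range]
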